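/- **Setting.** Let $\mathcal F_0$ (facility locations) and $\mathcal C$ (clients) be finite sets located in a metric space with metric $d$, let $k\in\mathbb N$, and let $r_j\ge 1$ be an integer for each $j\in\mathcal C$. For $A\subseteq\mathcal F_0$ let $d_{r_j}(j,A)=\min\{\sum_{i\in S}d(i,j): S\subseteq A,\ |S|=r_j\}$ ($+\infty$ if $|A|<r_j$), and for $T\ge0$ let $\mathcal L_T(i,j)=d(i,j)$ if $d(i,j)\ge T$ and $0$ otherwise. Let $(x,y)$ be a fractional solution: $\sum_i x_{ij}=r_j$ for all $j$, $\sum_i y_i=k$, and $0\le x_{ij}\le y_i\le 1$, such that each client uses its nearest volume, i.e. $x_{ij}=y_i$ whenever $d(i,j)<d(i',j)$ for some $i'$ with $x_{i'j}>0$. Put $d_{\mathsf{av}}(j)=r_j^{-1}\sum_i x_{ij}d(i,j)$. The random set $\hat F\subseteq\mathcal F_0$ is produced as follows. *Duplication.* Each location is replaced by co-located copies (with copy set $\mathcal F$ and $g:\mathcal F\to\mathcal F_0$) among which $y$ and $x$ are split so that $x_{ij}\in\{0,y_i\}$ for all copies $i$. Write $y(A)=\sum_{i\in A}y_i$, $d_{\max}(j,A)=\max_{i\in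 A}d(i,j)$, $\mathcal F_j=\{i\in\mathcal F:x_{ij}>0\}$. The duplication is fine enough that $\mathcal F_j$ is partitioned into $\mathcal F_{j,1},\dots,\mathcal F_{j,r_j}$, where $\mathcal F_{j,p}$ is the $p$-th closest unit volume to $j$, and that the closest unit volumes below exist. Let $a_j=\sum_{i\in\mathcal F_{j,r_j}}x_{ij}d(i,j)$ and $m_j=d_{\max}(j,\mathcal F_{j,r_j})$. *Bundles.* Start with $\mathcal Q_j=\emptyset$, $\mathcal F'_j=\mathcal F_j$, $\mathcal U=\emptyset$. While some $j$ has $|\mathcal Q_j|<r_j$, choose such a $j$ for which $d_{\max}(j,U)$ is minimum, where $U$ is the closest unit volume to $j$ in $\mathcal F'_j$. If $U$ meets some $U'\in\mathcal U$, append such a $U'$ to $\mathcal Q_j$ and remove $U'$ from $\mathcal F'_j$; otherwise append $U$ to $\mathcal Q_j$, add $U$ to $\mathcal U$ and remove $U$ from $\mathcal F'_j$. *Laminar family.* Call $j$ dangerous if $m_j>45a_j$; dangerous clients $j,j'$ are in conflict if $r_j=r_{j'}$ and $d(j,j')\le 6\max\{a_j,a_{j'}\}$. Go through the dangerous clients in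 non-decreasing order of $a_j$, and put $j$ into $D'$ iff it is not in conflict with a client put into $D'$ before. For $j\in D'$ let $B_j=\{i\in\mathcal F:d(i,j)\le m_j/15\}$ and, in non-decreasing order of $r_j$, let $B'_j$ be the union of $B_j$ and all $B'_{j'}$ with $j'\in D'$, $r_{j'}<r_j$, $B'_{j'}\cap B_j\ne\emptyset$. *Rounding.* Let $z'\in\{0,1\}^{\mathcal F}$ be a random vector with $\mathbb E[z']=y$ that almost surely satisfies $z'(U)=1$ for $U\in\mathcal U$, $r_j-1\le z'(B'_j)\le r_j$ for $j\in D'$, $z'(g^{-1}(i'))\le1$ for $i'\in\mathcal F_0$, and $z'(\mathcal F)=k$. Let $\hat F$ be the set of locations having a copy $i$ with $z'_i=1$. **Lemma.** For every such run of the procedure, every client $j\in\mathcal C$ and every $T\ge0$, there is an integrable random variable $X_j\ge0$ (on the probability space of $z'$) such that $$d_{r_j}(j,\hat F)\le 3r_j\,d_{\mathsf{av}}(j)+435.6\,T+X_j\quad\text{with probability }1,$$ $$\mathbb E[X_j]\le 226.7\sum_{i\in\mathcal F_0}x_{ij}\,\mathcal L_T(i,j).$$ -/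

import Mathlib

open MeasureTheory
open scoped NNReal

noncomputable section

namespace FaultTolerant

/-- An instance of fault-tolerant clustering: facility locations `F₀` and clients `C`, placed in a
(pseudo-)metric space `X` (distinct facilities or clients may share a point), the number `k` of
facilities to open, and the requirement `r j ≥ 1` of every client `j`. -/
structure Instance (X F₀ C : Type*) where
  facility : F₀ → X
  client : C → X
  k : ℕ
  r : C → ℕ
  r_pos : ∀ j, 0 < r j

section Original

variable {X F₀ C : Type*} [PseudoMetricSpace X] [Fintype F₀]

/-- The distance `d(i, j)` between a facility and a client. -/
def Instance.d (I : Instance X F₀ C) (i : F₀) (j : C) : ℝ :=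
  dist (I.facility i) (I.client j)

/-- `𝓛_T(i, j)`, which is `d(i, j)` if `d(i, j) ≥ T`, and `0` otherwise. -/
def Instance.trunc (I : Instance X F₀ C) (T : ℝ) (i : F₀) (j : C) : ℝ :=
  if T ≤ I.d i j then I.d i j else 0

/-- The constraints on the variables `x, y` of the fault-tolerant LP relaxation. (The remaining
constraints of the LP only bound its auxiliary objective variables from below.) -/
structure Instance.Feasible (I : Instance X F₀ C) (x : F₀ → C → ℝ) (y : F₀ → ℝ) : Prop where
  sum_assign : ∀ j, ∑ i, x i j = I.r j
  sum_open : ∑ i, y i = I.k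
  assign_nonneg : ∀ i j, 0 ≤ x i j
  assign_le_open : ∀ i j, x i j ≤ y i
  open_nonneg : ∀ i, 0 ≤ y i
  open_le_one : ∀ i, y i ≤ 1

/-- Every client uses its nearest volume: a facility strictly closer to `j` than some facility
used by `j` is used to its full extent. -/
def Instance.NearestAssignment (I : Instance X F₀ C) (x : F₀ → C → ℝ) (y : F₀ → ℝ) : Prop :=
  ∀ j i i', I.d i j < I.d i' j → 0 < x i' j → x i j = y i

/-- `d_av(j) = r_j⁻¹ ∑ i, x_ij d(i, j)`. -/
def Instance.dav (I : Instance X F₀ C) (x : F₀ → C → ℝ) (j : C) : ℝ :=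
  (I.r j : ℝ)⁻¹ * ∑ i, x i j * I.d i j

/-- The service cost `d_{r_j}(j, A) = min {∑ i ∈ S, d(i, j) : S ⊆ A, |S| = r_j}`, which is `+∞` if
`A` has fewer than `r_j` elements. -/
def Instance.serviceCost (I : Instance X F₀ C) (j : C) (A : Finset F₀) : EReal :=
  (A.powersetCard (I.r j)).inf fun S => ((∑ i ∈ S, I.d i j : ℝ) : EReal)

end Original

/-- A set `F` of co-located copies of facilities: the map `g` to the original locations, and the
assignment and opening variables of the copies. -/
structure Copies {X F₀ C : Type*} (I : Instance X F₀ C) (F : Type*) where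
  g : F → F₀
  x : F → C → ℝ
  y : F → ℝ

namespace Copies

variable {X F₀ C F : Type*} [PseudoMetricSpace X] [Fintype F] {I : Instance X F₀ C}

open Classical in
/-- `S` is a facility duplication of the fractional solution `(x, y)`: the variables of every
location are split among its copies, in such a way that `x_ij ∈ {0, y_i}` for the copies. -/
structure IsDuplication (S : Copies I F) (x : F₀ → C → ℝ) (y : F₀ → ℝ) : Prop where
  sum_x : ∀ i₀ j, ∑ i with S.g i = i₀, S.x i j = x i₀ j
  sum_y : ∀ i₀, ∑ i with S.g i = i₀, S.y i = y i₀
  y_nonneg : ∀ i, 0 ≤ S.y i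
  x_eq : ∀ i j, S.x i j = 0 ∨ S.x i j = S.y i

/-- The distance between a copy and a client. -/
def d (S : Copies I F) (i : F) (j : C) : ℝ := I.d (S.g i) j

/-- `F_j`, the copies fractionally connected to `j`. -/
def supp (S : Copies I F) (j : C) : Finset F := by
  classical exact Finset.univ.filter fun i => 0 < S.x i j

/-- The volume `y(A)`. -/
def vol (S : Copies I F) (A : Finset F) : ℝ := ∑ i ∈ A, S.y i

/-- `d_max(j, A)`, the largest distance between `j` and a member of the (nonempty) set `A`. -/
def dmax (S : Copies I F) (j : C) (A : Finset F) : ℝ :=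
  ((A.sup fun i => nndist (I.facility (S.g i)) (I.client j) : ℝ≥0) : ℝ)

/-- `Ball(j, R)`, the closed ball of copies. -/
def ball (S : Copies I F) (j : C) (R : ℝ) : Finset F := by
  classical exact Finset.univ.filter fun i => S.d i j ≤ R

/-- `F_j` is partitioned into `F_{j,1}, …, F_{j,r_j}` (here `P j 1, …, P j (r_j)`), where `F_{j,p}`
is the `p`-th closest unit volume to `j`. -/
structure IsUnitPartition (S : Copies I F) (P : C → ℕ → Finset F) : Prop where
  mem_supp_iff : ∀ j i, i ∈ S.supp j ↔ ∃ p, 1 ≤ p ∧ p ≤ I.r j ∧ i ∈ P j p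
  disjoint : ∀ j p q, 1 ≤ p → p < q → q ≤ I.r j → Disjoint (P j p) (P j q)
  vol_eq_one : ∀ j p, 1 ≤ p → p ≤ I.r j → S.vol (P j p) = 1
  ordered : ∀ j p q, 1 ≤ p → p < q → q ≤ I.r j →
    ∀ i ∈ P j p, ∀ i' ∈ P j q, S.d i j ≤ S.d i' j

/-- `d_av^{r_j}(j)`, the average distance to the last part `F_{j,r_j}`. -/
def davLast (S : Copies I F) (P : C → ℕ → Finset F) (j : C) : ℝ :=
  ∑ i ∈ P j (I.r j), S.x i j * S.d i j

/-- `d_max^{r_j}(j)`, the largest distance to the last part `F_{j,r_j}`. -/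
def dmaxLast (S : Copies I F) (P : C → ℕ → Finset F) (j : C) : ℝ :=
  S.dmax j (P j (I.r j))

/-! ### Bundle creation -/

/-- `U` is a closest unit volume to `j` in `A`. -/
def IsClosestUnit (S : Copies I F) (j : C) (A U : Finset F) : Prop :=
  U ⊆ A ∧ S.vol U = 1 ∧ ∀ i ∈ U, ∀ i' ∈ A, i' ∉ U → S.d i j ≤ S.d i' j

/-- The state of bundle creation: the queues `𝒬_j`, the remaining sets `F'_j`, and the set `𝒰` of
bundles. -/
structure BundleState (F C : Type*) where
  queue : C → List (Finset F)
  remaining : C → Finset F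
  bundles : Set (Finset F)

open Classical in
/-- Append `V` to the queue of `j` and remove it from `F'_j`; the set of bundles becomes `𝒰'`. -/
def BundleState.push {F C : Type*} (s : BundleState F C) (j : C) (V : Finset F)
    (𝒰' : Set (Finset F)) : BundleState F C where
  queue := Function.update s.queue j (s.queue j ++ [V])
  remaining := Function.update s.remaining j (s.remaining j \ V)
  bundles := 𝒰'

/-- The initial state. -/
def initState (S : Copies I F) : BundleState F C where
  queue := fun _ => []
  remaining := S.supp
  bundles := ∅

/-- In state `s`, the loop may choose client `j` with `U` its closest unit volume: the queue of `j`
is not full, and `d_max(j, U)` is minimum among all the clients whose queues are not full. -/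
def Selects (S : Copies I F) (s : BundleState F C) (j : C) (U : Finset F) : Prop :=
  (s.queue j).length < I.r j ∧ S.IsClosestUnit j (s.remaining j) U ∧
    ∀ j', (s.queue j').length < I.r j' →
      ∃ U', S.IsClosestUnit j' (s.remaining j') U' ∧ S.dmax j U ≤ S.dmax j' U'

/-- One iteration of the loop. -/
inductive BundleStep (S : Copies I F) : BundleState F C → BundleState F C → Prop
  | reuse (s : BundleState F C) (j : C) (U V : Finset F) (hsel : S.Selects s j U)
      (hV : V ∈ s.bundles) (hUV : ¬ Disjoint U V) : BundleStep S s (s.push j V s.bundles)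
  | create (s : BundleState F C) (j : C) (U : Finset F) (hsel : S.Selects s j U)
      (hU : ∀ V ∈ s.bundles, Disjoint U V) : BundleStep S s (s.push j U (insert U s.bundles))

/-- `s` is the state at the end of a complete run of bundle creation. -/
def IsBundleOutcome (S : Copies I F) (s : BundleState F C) : Prop :=
  Relation.ReflTransGen S.BundleStep S.initState s ∧ ∀ j, ¬ (s.queue j).length < I.r j

/-! ### Dangerous clients, filtering, and the laminar family -/

/-- Client `j` is dangerous. -/
def Dangerous (S : Copies I F) (P : C → ℕ → Finset F) (j : C) : Prop :=
  45 * S.davLast P j < S.dmaxLast P j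

/-- Clients `j` and `j'` are in conflict. -/
def Conflict (S : Copies I F) (P : C → ℕ → Finset F) (j j' : C) : Prop :=
  I.r j = I.r j' ∧
    dist (I.client j) (I.client j') ≤ 6 * max (S.davLast P j) (S.davLast P j')

/-- `L` lists the dangerous clients in non-decreasing order of `d_av^{r_j}(j)`. -/
def IsFilterOrder (S : Copies I F) (P : C → ℕ → Finset F) (L : List C) : Prop :=
  L.Nodup ∧ (∀ j, j ∈ L ↔ S.Dangerous P j) ∧
    L.Pairwise fun j j' => S.davLast P j ≤ S.davLast P j'

open Classical in
/-- The filtered set `D'`: go through the list, and keep a client iff it is unmarked, that is,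
not in conflict with a client kept before. -/
def filtered (S : Copies I F) (P : C → ℕ → Finset F) (L : List C) : Finset C :=
  L.foldl (fun D' j => if ∃ j' ∈ D', S.Conflict P j' j then D' else insert j D') ∅

/-- `B_j = Ball(j, d_max^{r_j}(j) / 15)`. -/
def core (S : Copies I F) (P : C → ℕ → Finset F) (j : C) : Finset F :=
  S.ball j (S.dmaxLast P j / 15)

open Classical in
/-- The laminar construction: `B'_j` is the union of `B_j` and all `B'_{j'}` with `j' ∈ D'`,
`r_{j'} < r_j` and `B'_{j'} ∩ B_j ≠ ∅`. -/
def laminarSet (S : Copies I F) (P : C → ℕ → Finset F) (D' : Finset C) (j : C) : Finset F :=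
  S.core P j ∪ (D'.filter fun j' => I.r j' < I.r j).attach.biUnion fun j' =>
    if Disjoint (laminarSet S P D' j'.1) (S.core P j) then ∅ else laminarSet S P D' j'.1
termination_by I.r j
decreasing_by all_goals exact (Finset.mem_filter.mp j'.2).2

/-! ### Rounding -/

open Classical in
/-- The constraints of the auxiliary LP. -/
structure AuxFeasible (S : Copies I F) (P : C → ℕ → Finset F) (𝒰 : Set (Finset F))
    (D' : Finset C) (z : F → ℝ) : Prop where
  bundle : ∀ U ∈ 𝒰, ∑ i ∈ U, z i = 1
  laminar : ∀ j ∈ D', ∑ i ∈ S.laminarSet P D' j, z i ∈ Set.Icc ((I.r j : ℝ) - 1) (I.r j)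
  location : ∀ i₀, ∑ i with S.g i = i₀, z i ≤ 1
  total : ∑ i, z i = I.k

/-- `z` is a random integral solution of the auxiliary LP with mean `y`. -/
structure IsRounding (S : Copies I F) (P : C → ℕ → Finset F) (𝒰 : Set (Finset F))
    (D' : Finset C) {Ω : Type*} [MeasurableSpace Ω] (μ : Measure Ω) (z : Ω → F → ℝ) : Prop where
  measurable : Measurable z
  integral_solution : ∀ᵐ ω ∂μ, (∀ i, z ω i = 0 ∨ z ω i = 1) ∧ S.AuxFeasible P 𝒰 D' (z ω)
  mean : ∀ i, ∫ ω, z ω i ∂μ = S.y i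

/-- The open facilities `F̂`, as a set of original locations. -/
def openLocations [Fintype F₀] (S : Copies I F) (z : F → ℝ) : Finset F₀ := by
  classical exact Finset.univ.filter fun i₀ => ∃ i, S.g i = i₀ ∧ z i = 1

end Copies

end FaultTolerant

end

set_option linter.unusedSectionVars false

namespace FaultTolerant.Copies

variable {X F₀ C F : Type*} [PseudoMetricSpace X] [Fintype F] {I : Instance X F₀ C}

/-! ### Distances and volumes -/

/-! Write `a`, `m` for `davLast`, `dmaxLast` of `j`, and `Λ` for `∑ i, x i j * I.trunc T i j`.

Every bundle contains exactly one open copy, and the queue of `j` holds `r_j` disjoint bundles, the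
`p`-th within `3 * S.dmax j (P j p)` (`IsBundleOutcome.exists_bundles`). Since the maximum over one
part is at most the average over the next, the first `r_j - 1` bundles cost at most `3 r_j d_av(j)`.
Only the last facility remains, available within `3 m`. If `3 m ≤ 435.6 T + 226.7 Λ`, a constant
excess suffices.

Otherwise `j` is dangerous, because `a ≤ T + Λ`, and filtering supplies a representative `j'` with
the same requirement at distance at most `6 a`. Let `B` be the laminar set of `j'`. If `B` has `r_j`
open copies, one of them is still unused by the first `r_j - 1` bundles; otherwise pay `3 m`. Both
cases are dominated by `ρ`, plus the distances to open copies of `B` beyond `ρ`, plus `3 m` times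
the number of openings missing in `B` (`AuxFeasible.serviceCost_le_laminar`). This bound is affine
in the rounded vector, so its expectation depends on the mean `y` alone. By nearest assignment `x =
y` on `B`, so the far term is part of the fractional cost of `j`; the missing volume is served
outside the core of `j'`, at distance of order `m`, so by Markov's inequality the last term is small
as well. `IsUnitPartition.exists_threshold` chooses `ρ` according to whether `a` or `T` dominates.
-/

lemma d_nonneg (S : Copies I F) (i : F) (j : C) : 0 ≤ S.d i j := dist_nonneg

lemma d_triangle (S : Copies I F) (i : F) (j j' : C) :
    S.d i j ≤ S.d i j' + dist (I.client j) (I.client j') := by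
  rw [dist_comm (I.client j)]
  exact dist_triangle _ _ _

lemma dmax_nonneg (S : Copies I F) (j : C) (A : Finset F) : 0 ≤ S.dmax j A := NNReal.coe_nonneg _

lemma d_le_dmax (S : Copies I F) {i : F} {A : Finset F} (j : C) (hi : i ∈ A) :
    S.d i j ≤ S.dmax j A := by
  have := Finset.le_sup (f := fun i => nndist (I.facility (S.g i)) (I.client j)) hi
  exact_mod_cast this

lemma dmax_le (S : Copies I F) {j : C} {A : Finset F} {c : ℝ} (hc : 0 ≤ c)
    (h : ∀ i ∈ A, S.d i j ≤ c) : S.dmax j A ≤ c := by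
  lift c to ℝ≥0 using hc
  refine NNReal.coe_le_coe.2 (Finset.sup_le fun i hi => ?_)
  exact_mod_cast h i hi

lemma mem_supp (S : Copies I F) {i : F} {j : C} : i ∈ S.supp j ↔ 0 < S.x i j := by
  simp [supp]

lemma mem_ball (S : Copies I F) {i : F} {j : C} {R : ℝ} : i ∈ S.ball j R ↔ S.d i j ≤ R := by
  simp [ball]

/-! ### Copies inherit the properties of the fractional solution. -/

namespace IsDuplication

variable {S : Copies I F} {x : F₀ → C → ℝ} {y : F₀ → ℝ}

lemma x_nonneg (h : S.IsDuplication x y) (i : F) (j : C) : 0 ≤ S.x i j := by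
  rcases h.x_eq i j with e | e <;> rw [e]
  exact h.y_nonneg i

lemma x_le_y (h : S.IsDuplication x y) (i : F) (j : C) : S.x i j ≤ S.y i := by
  rcases h.x_eq i j with e | e <;> rw [e]
  exact h.y_nonneg i

lemma x_eq_y_of_mem_supp (h : S.IsDuplication x y) {i : F} {j : C} (hi : i ∈ S.supp j) :
    S.x i j = S.y i :=
  (h.x_eq i j).resolve_left (S.mem_supp.1 hi).ne'

lemma x_eq_zero_of_notMem_supp (h : S.IsDuplication x y) {i : F} {j : C} (hi : i ∉ S.supp j) :
    S.x i j = 0 :=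
  le_antisymm (not_lt.1 fun h' => hi (S.mem_supp.2 h')) (h.x_nonneg i j)

lemma y_pos_of_mem_supp (h : S.IsDuplication x y) {i : F} {j : C} (hi : i ∈ S.supp j) :
    0 < S.y i := by
  rw [← h.x_eq_y_of_mem_supp hi]
  exact S.mem_supp.1 hi

lemma vol_mono (h : S.IsDuplication x y) {A B : Finset F} (hAB : A ⊆ B) : S.vol A ≤ S.vol B :=
  Finset.sum_le_sum_of_subset_of_nonneg hAB fun i _ _ => h.y_nonneg i

lemma sum_x_mul [Fintype F₀] (h : S.IsDuplication x y) (j : C) (f : F₀ → ℝ) :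
    ∑ i, S.x i j * f (S.g i) = ∑ i, x i j * f i := by
  classical
  rw [← Finset.sum_fiberwise Finset.univ S.g]
  refine Finset.sum_congr rfl fun i₀ _ => ?_
  rw [← h.sum_x i₀ j, Finset.sum_mul]
  refine Finset.sum_congr (by congr) fun i hi => ?_
  rw [(Finset.mem_filter.1 hi).2]

lemma sum_x_eq [Fintype F₀] (h : S.IsDuplication x y) (hfeas : I.Feasible x y) (j : C) :
    ∑ i, S.x i j = I.r j := by
  simpa [hfeas.sum_assign] using h.sum_x_mul j fun _ => 1

lemma sum_x_mul_d [Fintype F₀] (h : S.IsDuplication x y) (j : C) :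
    ∑ i, S.x i j * S.d i j = I.r j * I.dav x j := by
  have hr : (I.r j : ℝ) ≠ 0 := by exact_mod_cast (I.r_pos j).ne'
  rw [Instance.dav, mul_inv_cancel_left₀ hr]
  exact h.sum_x_mul j fun i => I.d i j

/-- A copy that is strictly closer than some copy used by `j` is used by `j`. -/
lemma x_eq_y_of_lt (h : S.IsDuplication x y) (hnear : I.NearestAssignment x y)
    {i i' : F} {j : C} (hlt : S.d i j < S.d i' j) (hi' : 0 < S.x i' j) : S.x i j = S.y i := by
  classical
  have hx' : 0 < x (S.g i') j := by
    rw [← h.sum_x]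
    refine hi'.trans_le (Finset.single_le_sum (f := fun i => S.x i j)
      (fun i _ => h.x_nonneg i j) ?_)
    simp
  have key : x (S.g i) j = y (S.g i) := hnear j (S.g i) (S.g i') hlt hx'
  -- Equality holds between the fibre sums while `x ≤ y` copy by copy, so it holds for every copy.
  rw [← h.sum_x, ← h.sum_y, Finset.sum_eq_sum_iff_of_le fun i _ => h.x_le_y i j] at key
  exact key i (by simp)

end IsDuplication

/-! ### Unit parts of a client, and comparison of `dmaxLast` between clients. -/

namespace IsUnitPartition

variable {S : Copies I F} {x : F₀ → C → ℝ} {y : F₀ → ℝ} {P : C → ℕ → Finset F}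

lemma subset_supp (hP : S.IsUnitPartition P) {j : C} {p : ℕ} (h1 : 1 ≤ p) (h2 : p ≤ I.r j) :
    P j p ⊆ S.supp j := fun i hi => (hP.mem_supp_iff j i).2 ⟨p, h1, h2, hi⟩

lemma nonempty (hP : S.IsUnitPartition P) {j : C} {p : ℕ} (h1 : 1 ≤ p) (h2 : p ≤ I.r j) :
    (P j p).Nonempty := by
  rw [Finset.nonempty_iff_ne_empty]
  intro h0
  have := hP.vol_eq_one j p h1 h2
  simp [h0, vol] at this

lemma dmax_le_d (hP : S.IsUnitPartition P) {j : C} {p q : ℕ} (h1 : 1 ≤ p) (hpq : p < q)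
    (h2 : q ≤ I.r j) {i : F} (hi : i ∈ P j q) : S.dmax j (P j p) ≤ S.d i j :=
  S.dmax_le (S.d_nonneg i j) fun i' hi' => hP.ordered j p q h1 hpq h2 i' hi' i hi

lemma dmax_mono (hP : S.IsUnitPartition P) {j : C} {p q : ℕ} (h1 : 1 ≤ p) (hpq : p ≤ q)
    (h2 : q ≤ I.r j) : S.dmax j (P j p) ≤ S.dmax j (P j q) := by
  rcases hpq.eq_or_lt with rfl | hlt
  · rfl
  obtain ⟨i, hi⟩ := hP.nonempty (h1.trans hpq) h2
  exact (hP.dmax_le_d h1 hlt h2 hi).trans (S.d_le_dmax j hi)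

/-- The largest distance to a part is at most the average distance to a later part. -/
lemma dmax_le_avg (hP : S.IsUnitPartition P) (h : S.IsDuplication x y) {j : C} {p q : ℕ}
    (h1 : 1 ≤ p) (hpq : p < q) (h2 : q ≤ I.r j) :
    S.dmax j (P j p) ≤ ∑ i ∈ P j q, S.x i j * S.d i j := by
  have hv := hP.vol_eq_one j q (by omega) h2
  calc S.dmax j (P j p) = ∑ i ∈ P j q, S.y i * S.dmax j (P j p) := by
        rw [← Finset.sum_mul]; unfold vol at hv; rw [hv, one_mul]
    _ ≤ _ := Finset.sum_le_sum fun i hi => by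
        rw [h.x_eq_y_of_mem_supp (hP.subset_supp (by omega) h2 hi)]
        exact mul_le_mul_of_nonneg_left (hP.dmax_le_d h1 hpq h2 hi) (h.y_nonneg i)

open Classical in
lemma sum_biUnion (hP : S.IsUnitPartition P) (j : C) {q : ℕ} (hq : q ≤ I.r j) (f : F → ℝ) :
    ∑ i ∈ (Finset.Icc 1 q).biUnion (P j), f i = ∑ p ∈ Finset.Icc 1 q, ∑ i ∈ P j p, f i := by
  refine Finset.sum_biUnion fun p hp p' hp' hne => ?_
  simp only [Finset.coe_Icc, Set.mem_Icc] at hp hp'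
  rcases lt_or_gt_of_ne hne with hlt | hlt
  · exact hP.disjoint j p p' hp.1 hlt (by omega)
  · exact (hP.disjoint j p' p hp'.1 hlt (by omega)).symm

open Classical in
lemma vol_biUnion (hP : S.IsUnitPartition P) (j : C) {q : ℕ} (hq : q ≤ I.r j) :
    S.vol ((Finset.Icc 1 q).biUnion (P j)) = q := by
  have h1 : ∀ p ∈ Finset.Icc 1 q, ∑ i ∈ P j p, S.y i = 1 := fun p hp =>
    hP.vol_eq_one j p (Finset.mem_Icc.1 hp).1 ((Finset.mem_Icc.1 hp).2.trans hq)
  rw [vol, hP.sum_biUnion j hq, Finset.sum_congr rfl h1]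
  simp

lemma sum_parts_le (hP : S.IsUnitPartition P) (h : S.IsDuplication x y) (j : C) :
    ∑ p ∈ Finset.Icc 1 (I.r j), ∑ i ∈ P j p, S.x i j * S.d i j ≤ ∑ i, S.x i j * S.d i j := by
  classical
  rw [← hP.sum_biUnion j le_rfl]
  exact Finset.sum_le_sum_of_subset_of_nonneg (Finset.subset_univ _)
    fun i _ _ => mul_nonneg (h.x_nonneg i j) (S.d_nonneg i j)

lemma davLast_nonneg (h : S.IsDuplication x y) (j : C) : 0 ≤ S.davLast P j :=
  Finset.sum_nonneg fun i _ => mul_nonneg (h.x_nonneg i j) (S.d_nonneg i j)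

/-- The members of `F_j` outside of the last part are at distance at most `d_av^{r_j}(j)`. -/
lemma d_le_davLast (hP : S.IsUnitPartition P) (h : S.IsDuplication x y) {j : C} {i : F}
    (hi : i ∈ S.supp j) (hi' : i ∉ P j (I.r j)) : S.d i j ≤ S.davLast P j := by
  obtain ⟨p, h1, h2, hp⟩ := (hP.mem_supp_iff j i).1 hi
  have hlt : p < I.r j := lt_of_le_of_ne h2 (by rintro rfl; exact hi' hp)
  exact (S.d_le_dmax j hp).trans (hP.dmax_le_avg h h1 hlt le_rfl)

/-- The members of `F_j` further away than `d_av^{r_j}(j)` contribute at most `d_av^{r_j}(j)`. -/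
lemma sum_far_le_davLast (hP : S.IsUnitPartition P) (h : S.IsDuplication x y) (j : C)
    (A : Finset F) (hA : ∀ i ∈ A, S.davLast P j < S.d i j) :
    ∑ i ∈ A, S.x i j * S.d i j ≤ S.davLast P j := by
  classical
  rw [davLast, ← Finset.sum_filter_add_sum_filter_not A (· ∈ P j (I.r j)),
    Finset.sum_eq_zero (s := A.filter (· ∉ P j (I.r j))), add_zero]
  · exact Finset.sum_le_sum_of_subset_of_nonneg (fun i hi => (Finset.mem_filter.1 hi).2)
      fun i _ _ => mul_nonneg (h.x_nonneg i j) (S.d_nonneg i j)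
  · intro i hi
    rw [Finset.mem_filter] at hi
    rw [h.x_eq_zero_of_notMem_supp fun hs => (hA i hi.1).not_ge (hP.d_le_davLast h hs hi.2),
      zero_mul]

lemma exists_far (hP : S.IsUnitPartition P) {j : C} {ρ : ℝ} (hρ : 0 ≤ ρ)
    (h : ρ < S.dmaxLast P j) : ∃ i, 0 < S.x i j ∧ ρ < S.d i j := by
  by_contra! hcon
  refine h.not_ge (S.dmax_le hρ fun i hi => hcon i ?_)
  exact S.mem_supp.1 (hP.subset_supp (I.r_pos j) le_rfl hi)

lemma x_eq_y_of_lt_dmaxLast (hP : S.IsUnitPartition P) (h : S.IsDuplication x y)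
    (hnear : I.NearestAssignment x y) {i : F} {j : C} (hi : S.d i j < S.dmaxLast P j) :
    S.x i j = S.y i := by
  obtain ⟨i', hx, hd⟩ := hP.exists_far (S.d_nonneg i j) hi
  exact h.x_eq_y_of_lt hnear hd hx

variable [Fintype F₀]

/-- A used copy beyond `ρ` would force the whole ball to be fully used, by nearest assignment;
together they would receive more than `r_j`. -/
lemma dmaxLast_le (hP : S.IsUnitPartition P) (h : S.IsDuplication x y)
    (hnear : I.NearestAssignment x y) (hfeas : I.Feasible x y) {j : C} {ρ : ℝ} (hρ : 0 ≤ ρ)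
    (hvol : (I.r j : ℝ) ≤ S.vol (S.ball j ρ)) : S.dmaxLast P j ≤ ρ := by
  classical
  by_contra! hlt
  obtain ⟨i, hx, hd⟩ := hP.exists_far hρ hlt
  have hi : i ∉ S.ball j ρ := by rw [mem_ball]; exact hd.not_ge
  have hle : ∑ i ∈ insert i (S.ball j ρ), S.x i j ≤ ∑ i, S.x i j :=
    Finset.sum_le_sum_of_subset_of_nonneg (Finset.subset_univ _) fun i _ _ => h.x_nonneg i j
  rw [Finset.sum_insert hi, h.sum_x_eq hfeas] at hle
  have hb : ∑ i ∈ S.ball j ρ, S.x i j = S.vol (S.ball j ρ) :=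
    Finset.sum_congr rfl fun i' hi' => h.x_eq_y_of_lt hnear ((S.mem_ball.1 hi').trans_lt hd) hx
  linarith

/-- Comparison of `d_max^{r_j}` for two clients with the same requirement. -/
lemma dmaxLast_le_add_dist (hP : S.IsUnitPartition P) (h : S.IsDuplication x y)
    (hnear : I.NearestAssignment x y) (hfeas : I.Feasible x y) {j j' : C} (hr : I.r j = I.r j') :
    S.dmaxLast P j ≤ S.dmaxLast P j' + dist (I.client j) (I.client j') := by
  classical
  refine hP.dmaxLast_le h hnear hfeas (add_nonneg (S.dmax_nonneg _ _) dist_nonneg) ?_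
  rw [hr, ← hP.vol_biUnion j' le_rfl]
  refine h.vol_mono fun i hi => ?_
  simp only [Finset.mem_biUnion, Finset.mem_Icc] at hi
  obtain ⟨p, ⟨h1, h2⟩, hp⟩ := hi
  rw [mem_ball]
  have := S.d_triangle i j j'
  have := S.d_le_dmax j' hp
  have := hP.dmax_mono h1 h2 le_rfl
  unfold dmaxLast
  linarith

/-- A client with a smaller requirement than `j` finds its whole volume among the facilities at
distance at most `d_av^{r_j}(j)` from `j`. -/
lemma dmaxLast_le_davLast_add_dist (hP : S.IsUnitPartition P) (h : S.IsDuplication x y)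
    (hnear : I.NearestAssignment x y) (hfeas : I.Feasible x y) {j j' : C} (hr : I.r j' < I.r j) :
    S.dmaxLast P j' ≤ S.davLast P j + dist (I.client j') (I.client j) := by
  classical
  refine hP.dmaxLast_le h hnear hfeas (add_nonneg (davLast_nonneg h j) dist_nonneg) ?_
  rw [← hP.vol_biUnion j hr.le]
  refine h.vol_mono fun i hi => ?_
  simp only [Finset.mem_biUnion, Finset.mem_Icc] at hi
  obtain ⟨p, ⟨h1, h2⟩, hp⟩ := hi
  rw [mem_ball]
  have := S.d_triangle i j' j
  have := S.d_le_dmax j hp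
  have : S.dmax j (P j p) ≤ S.davLast P j := hP.dmax_le_avg h h1 (by omega) le_rfl
  linarith

end IsUnitPartition

end FaultTolerant.Copies

namespace FaultTolerant.Copies

variable {X F₀ C F : Type*} [PseudoMetricSpace X] [Fintype F] {I : Instance X F₀ C}

/-! ### Bundle creation -/

/-- The invariant of bundle creation. -/
structure BundleInvariant (S : Copies I F) (P : C → ℕ → Finset F) (s : BundleState F C) :
    Prop where
  length_le : ∀ j, (s.queue j).length ≤ I.r j
  remaining_subset : ∀ j, s.remaining j ⊆ S.supp j
  mem_bundles : ∀ j, ∀ V ∈ s.queue j, V ∈ s.bundles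
  disjoint_remaining : ∀ j, ∀ V ∈ s.queue j, Disjoint V (s.remaining j)
  nodup : ∀ j, (s.queue j).Nodup
  pairwise_disjoint : s.bundles.PairwiseDisjoint id
  vol_eq_one : ∀ V ∈ s.bundles, S.vol V = 1
  -- Each queue entry destroys at most one unit of volume of `A`, even if it sticks out of `F_j`.
  vol_removed : ∀ j, ∀ A ⊆ S.supp j, ∃ B ⊆ A, B ⊆ s.remaining j ∧
    S.vol A ≤ S.vol B + (s.queue j).length
  -- Minimality at the creation of `V`; it survives later steps because queues only grow and later
  -- parts are farther away.
  creator : ∀ V ∈ s.bundles, ∃ j₁, ∀ j, (s.queue j).length < I.r j →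
    S.dmax j₁ V ≤ S.dmax j (P j ((s.queue j).length + 1))
  -- List positions start at 0, parts at 1.
  near : ∀ j p V, (s.queue j)[p]? = some V → ∀ i ∈ V, S.d i j ≤ 3 * S.dmax j (P j (p + 1))

variable {S : Copies I F} {x : F₀ → C → ℝ} {y : F₀ → ℝ} {P : C → ℕ → Finset F}

lemma bundleInvariant_initState (S : Copies I F) (P : C → ℕ → Finset F) :
    S.BundleInvariant P S.initState where
  length_le := by simp [initState]
  remaining_subset := by simp [initState]
  mem_bundles := by simp [initState]
  disjoint_remaining := by simp [initState]
  nodup := by simp [initState]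
  pairwise_disjoint := by simp [initState]
  vol_eq_one := by simp [initState]
  vol_removed j A hA := ⟨A, subset_rfl, hA, by simp [initState]⟩
  creator := by simp [initState]
  near := by simp [initState]

namespace BundleInvariant

/-- The closest remaining unit volume is no further away than the next part of `F_j`. -/
lemma dmax_closest_le {s : BundleState F C} (hs : S.BundleInvariant P s)
    (h : S.IsDuplication x y) (hP : S.IsUnitPartition P) {j : C}
    (hj : (s.queue j).length < I.r j) {U : Finset F}
    (hU : S.IsClosestUnit j (s.remaining j) U) :
    S.dmax j U ≤ S.dmax j (P j ((s.queue j).length + 1)) := by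
  classical
  set q := (s.queue j).length with hq
  refine S.dmax_le (S.dmax_nonneg _ _) fun i hi => ?_
  by_contra! hlt
  have hsub : (Finset.Icc 1 (q + 1)).biUnion (P j) ⊆ S.supp j := fun i' hi' => by
    simp only [Finset.mem_biUnion, Finset.mem_Icc] at hi'
    obtain ⟨p, ⟨h1, h2⟩, hp⟩ := hi'
    exact hP.subset_supp h1 (by omega) hp
  -- The first `q + 1` parts lose at most volume `q`, so a volume of at least 1 survives in `B`, all
  -- of it strictly closer than `i`. Then `U` would contain `B` and also `i`, which has positive
  -- volume.
  obtain ⟨B, hBA, hBr, hB⟩ := hs.vol_removed j _ hsub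
  have hdB : ∀ i' ∈ B, S.d i' j < S.d i j := fun i' hi' => by
    have := hBA hi'
    simp only [Finset.mem_biUnion, Finset.mem_Icc] at this
    obtain ⟨p, ⟨h1, h2⟩, hp⟩ := this
    exact ((S.d_le_dmax j hp).trans (hP.dmax_mono h1 h2 (by omega))).trans_lt hlt
  have hiB : i ∉ B := fun hi' => (hdB i hi').false
  have hBU : insert i B ⊆ U := Finset.insert_subset hi fun i' hi' => by
    by_contra hn
    exact (hdB i' hi').not_ge (hU.2.2 i hi i' (hBr hi') hn)
  have hle := h.vol_mono hBU
  rw [hU.2.1, vol, Finset.sum_insert hiB] at hle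
  rw [hP.vol_biUnion j (by omega), ← hq] at hB
  have hy := h.y_pos_of_mem_supp (hs.remaining_subset j (hU.1 hi))
  unfold vol at hB
  push_cast at hB
  linarith

/-- The invariant is preserved when a set `V` is appended to the queue of `j`. -/
lemma push {s : BundleState F C} (hs : S.BundleInvariant P s) (h : S.IsDuplication x y)
    (hP : S.IsUnitPartition P) {j : C}
    (hj : (s.queue j).length < I.r j) {V : Finset F} {𝒰 : Set (Finset F)}
    (hsub : s.bundles ⊆ 𝒰) (hV : V ∈ 𝒰) (hnotMem : V ∉ s.queue j)
    (hdisj : 𝒰.PairwiseDisjoint id) (hvol : ∀ W ∈ 𝒰, S.vol W = 1)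
    (hcreator : ∀ W ∈ 𝒰, ∃ j₁, ∀ j, (s.queue j).length < I.r j →
      S.dmax j₁ W ≤ S.dmax j (P j ((s.queue j).length + 1)))
    (hnear : ∀ i ∈ V, S.d i j ≤ 3 * S.dmax j (P j ((s.queue j).length + 1))) :
    S.BundleInvariant P (s.push j V 𝒰) where
  length_le j' := by
    have := hs.length_le j'
    by_cases e : j' = j
    · subst e; simp [BundleState.push]; omega
    · simpa [BundleState.push, e] using this
  remaining_subset j' := by
    classical
    have := hs.remaining_subset j'
    by_cases e : j' = j
    · subst e; simpa [BundleState.push] using Finset.sdiff_subset.trans this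
    · simpa [BundleState.push, e] using this
  mem_bundles j' W hW := by
    classical
    by_cases e : j' = j
    · subst e
      simp only [BundleState.push, Function.update_self, List.mem_append, List.mem_singleton] at hW
      rcases hW with hW | rfl
      · exact hsub (hs.mem_bundles _ W hW)
      · exact hV
    · simp only [BundleState.push, Function.update_of_ne e] at hW
      exact hsub (hs.mem_bundles _ W hW)
  disjoint_remaining j' W hW := by
    classical
    by_cases e : j' = j
    · subst e
      simp only [BundleState.push, Function.update_self, List.mem_append,
        List.mem_singleton] at hW ⊢
      rcases hW with hW | rfl
      · exact (hs.disjoint_remaining _ W hW).mono_right Finset.sdiff_subset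
      · exact Finset.disjoint_sdiff
    · simp only [BundleState.push, Function.update_of_ne e] at hW ⊢
      exact hs.disjoint_remaining _ W hW
  nodup j' := by
    have := hs.nodup j'
    by_cases e : j' = j
    · subst e
      simp only [BundleState.push, Function.update_self]
      exact List.nodup_append.2 ⟨this, List.nodup_singleton _, by
        rintro a ha b hb rfl
        rw [List.mem_singleton] at hb
        exact hnotMem (hb ▸ ha)⟩
    · simpa [BundleState.push, e] using this
  pairwise_disjoint := hdisj
  vol_eq_one := hvol
  vol_removed j' A hA := by
    classical
    obtain ⟨B, hBA, hBr, hB⟩ := hs.vol_removed j' A hA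
    by_cases e : j' = j
    · subst e
      simp only [BundleState.push, Function.update_self, List.length_append,
        List.length_singleton]
      refine ⟨B \ V, Finset.sdiff_subset.trans hBA, ?_, ?_⟩
      · convert Finset.sdiff_subset_sdiff hBr subset_rfl
      · have h1 : S.vol (B ∩ V) ≤ 1 := (h.vol_mono Finset.inter_subset_right).trans (hvol V hV).le
        have h2 : S.vol (B ∩ V) + S.vol (B \ V) = S.vol B :=
          Finset.sum_inter_add_sum_sdiff B V S.y
        push_cast
        linarith
    · exact ⟨B, hBA, by simpa [BundleState.push, e] using hBr,
        by simpa [BundleState.push, e] using hB⟩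
  creator W hW := by
    classical
    obtain ⟨j₁, h₁⟩ := hcreator W hW
    refine ⟨j₁, fun j' hj' => ?_⟩
    by_cases e : j' = j
    · subst e
      simp only [BundleState.push, Function.update_self, List.length_append,
        List.length_singleton] at hj' ⊢
      exact (h₁ _ (by omega)).trans (hP.dmax_mono (by omega) (by omega) (by omega))
    · simp only [BundleState.push, Function.update_of_ne e] at hj' ⊢
      exact h₁ _ hj'
  near j' p W hW i hi := by
    classical
    by_cases e : j' = j
    · subst e
      simp only [BundleState.push, Function.update_self] at hW
      rcases lt_trichotomy p (s.queue j').length with hp | rfl | hp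
      · rw [List.getElem?_append_left hp] at hW
        exact hs.near _ p W hW i hi
      · rw [List.getElem?_concat_length, Option.some_inj] at hW
        exact hnear i (hW ▸ hi)
      · rw [List.getElem?_eq_none (by simp; omega)] at hW
        cases hW
    · simp only [BundleState.push, Function.update_of_ne e] at hW
      exact hs.near _ p W hW i hi

lemma step {s s' : BundleState F C} (hs : S.BundleInvariant P s) (h : S.IsDuplication x y)
    (hP : S.IsUnitPartition P) (hstep : S.BundleStep s s') : S.BundleInvariant P s' := by
  cases hstep with
  | reuse j U V hsel hV hUV =>
    obtain ⟨hj, hU, -⟩ := hsel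
    refine hs.push h hP hj subset_rfl hV (fun hq => hUV ?_) hs.pairwise_disjoint hs.vol_eq_one
      hs.creator fun i hi => ?_
    · exact (hs.disjoint_remaining j V hq).symm.mono_left hU.1
    -- From `j` to a common point of `U` and `V`, on to the creator `j₁`, then to `i`: each of the
    -- three legs is at most the radius of the next part.
    · obtain ⟨j₁, h₁⟩ := hs.creator V hV
      obtain ⟨i', hiU, hiV⟩ := Finset.not_disjoint_iff.1 hUV
      have e1 := h₁ j hj
      have e2 := hs.dmax_closest_le h hP hj hU
      have e3 := S.d_le_dmax j₁ hi
      have e4 := S.d_le_dmax j₁ hiV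
      have e5 := S.d_le_dmax j hiU
      have e6 := S.d_triangle i j j₁
      have e7 : dist (I.client j) (I.client j₁) ≤ S.d i' j + S.d i' j₁ :=
        dist_triangle_left _ _ _
      linarith
  | create j U hsel hU' =>
    obtain ⟨hj, hU, hmin⟩ := hsel
    have hne : U.Nonempty := by
      rw [Finset.nonempty_iff_ne_empty]
      intro h0
      have := hU.2.1
      simp [h0, vol] at this
    refine hs.push h hP hj (Set.subset_insert _ _) (Set.mem_insert _ _) (fun hq => ?_) ?_ ?_ ?_
      fun i hi => ?_
    · exact hne.ne_empty (Finset.disjoint_self_iff_empty _ |>.1 (hU' U (hs.mem_bundles j U hq)))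
    · exact hs.pairwise_disjoint.insert fun V hV _ => hU' V hV
    · rintro W (rfl | hW)
      · exact hU.2.1
      · exact hs.vol_eq_one W hW
    · rintro W (rfl | hW)
      · refine ⟨j, fun j' hj' => ?_⟩
        obtain ⟨U', hcl, hle⟩ := hmin j' hj'
        exact hle.trans (hs.dmax_closest_le h hP hj' hcl)
      · exact hs.creator W hW
    · have e1 := hs.dmax_closest_le h hP hj hU
      have e2 := S.d_le_dmax j hi
      have e3 := S.dmax_nonneg j (P j ((s.queue j).length + 1))
      linarith

end BundleInvariant

/-- The final queue of `j` provides `r_j` disjoint bundles, the `p`-th of which is within three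
times the largest distance to the `p`-th part of `F_j`. -/
lemma IsBundleOutcome.exists_bundles {s : BundleState F C} (hs : S.IsBundleOutcome s)
    (h : S.IsDuplication x y) (hP : S.IsUnitPartition P) (j : C) :
    ∃ Q : ℕ → Finset F, (∀ p ∈ Finset.Icc 1 (I.r j), Q p ∈ s.bundles) ∧
      (∀ p ∈ Finset.Icc 1 (I.r j), ∀ q ∈ Finset.Icc 1 (I.r j), p ≠ q → Disjoint (Q p) (Q q)) ∧
      ∀ p ∈ Finset.Icc 1 (I.r j), ∀ i ∈ Q p, S.d i j ≤ 3 * S.dmax j (P j p) := by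
  have inv : S.BundleInvariant P s := by
    have hrun := hs.1
    clear hs
    induction hrun with
    | refl => exact bundleInvariant_initState S P
    | tail _ hstep ih => exact ih.step h hP hstep
  have hlen : (s.queue j).length = I.r j := le_antisymm (inv.length_le j) (not_lt.1 (hs.2 j))
  have hget : ∀ p ∈ Finset.Icc 1 (I.r j),
      (s.queue j)[p - 1]? = some ((s.queue j).getD (p - 1) ∅) := fun p hp => by
    rw [Finset.mem_Icc] at hp
    rw [List.getD_eq_getElem?_getD, List.getElem?_eq_getElem (by omega)]
    rfl
  refine ⟨fun p => (s.queue j).getD (p - 1) ∅, fun p hp => ?_, fun p hp q hq hpq => ?_,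
    fun p hp i hi => ?_⟩
  · exact inv.mem_bundles j _ (List.mem_of_getElem? (hget p hp))
  · refine inv.pairwise_disjoint (inv.mem_bundles j _ (List.mem_of_getElem? (hget p hp)))
      (inv.mem_bundles j _ (List.mem_of_getElem? (hget q hq))) fun e => hpq ?_
    have e' := (hget p hp).trans ((congrArg some e).trans (hget q hq).symm)
    rw [Finset.mem_Icc] at hp hq
    have := (List.getElem?_inj (by omega) (inv.nodup j)).1 e'
    omega
  · have := inv.near j (p - 1) _ (hget p hp) i hi
    rwa [Nat.sub_add_cancel (Finset.mem_Icc.1 hp).1] at this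

end FaultTolerant.Copies

namespace FaultTolerant.Copies

variable {X F₀ C F : Type*} [PseudoMetricSpace X] [Fintype F] {I : Instance X F₀ C}
  {S : Copies I F} {x : F₀ → C → ℝ} {y : F₀ → ℝ} {P : C → ℕ → Finset F}

/-! ### Filtering and the laminar family -/

section Filtering

open Classical in
/-- One step of the filtering procedure. -/
noncomputable def filterStep (S : Copies I F) (P : C → ℕ → Finset F) (D : Finset C) (j : C) : Finset C :=
  if ∃ j' ∈ D, S.Conflict P j' j then D else insert j D

lemma subset_filterStep (S : Copies I F) (P : C → ℕ → Finset F) (D : Finset C) (j : C) :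
    D ⊆ S.filterStep P D j := by
  classical
  unfold filterStep
  split_ifs
  · exact subset_rfl
  · exact Finset.subset_insert _ _

lemma subset_foldl_filterStep (S : Copies I F) (P : C → ℕ → Finset F) (L : List C)
    (D : Finset C) : D ⊆ L.foldl (S.filterStep P) D := by
  induction L generalizing D with
  | nil => exact subset_rfl
  | cons j L ih => exact (S.subset_filterStep P D j).trans (ih _)

lemma mem_filterStep {D : Finset C} {j j' : C} (h : j' ∈ S.filterStep P D j) :
    j' ∈ D ∨ j' = j := by
  classical
  unfold filterStep at h
  split_ifs at h
  · exact Or.inl h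
  · exact (Finset.mem_insert.1 h).symm

lemma mem_foldl_filterStep {L : List C} {D : Finset C} {j : C}
    (h : j ∈ L.foldl (S.filterStep P) D) : j ∈ D ∨ j ∈ L := by
  induction L generalizing D with
  | nil => exact Or.inl h
  | cons j' L ih =>
    rcases ih h with h | h
    · rcases mem_filterStep h with h | rfl
      · exact Or.inl h
      · exact Or.inr List.mem_cons_self
    · exact Or.inr (List.mem_cons_of_mem _ h)

/-- A client is either kept or rejected by one kept earlier. The sorted order makes the earlier
`davLast` the smaller one, so the maximum in the conflict condition is that of `j`. The hypothesis
`hD` carries the order through the accumulator. -/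
lemma exists_mem_foldl_filterStep (hnn : ∀ j, 0 ≤ S.davLast P j) {L : List C} {D : Finset C}
    (hL : L.Pairwise fun j j' => S.davLast P j ≤ S.davLast P j')
    (hD : ∀ j' ∈ D, ∀ j ∈ L, S.davLast P j' ≤ S.davLast P j) {j : C} (hj : j ∈ L) :
    ∃ j' ∈ L.foldl (S.filterStep P) D, I.r j' = I.r j ∧ S.davLast P j' ≤ S.davLast P j ∧
      dist (I.client j') (I.client j) ≤ 6 * S.davLast P j := by
  classical
  induction L generalizing D with
  | nil => cases hj
  | cons j₁ L ih =>
    rw [List.pairwise_cons] at hL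
    rcases List.mem_cons.1 hj with rfl | hj
    · suffices h : ∃ j' ∈ S.filterStep P D j, I.r j' = I.r j ∧
          S.davLast P j' ≤ S.davLast P j ∧
          dist (I.client j') (I.client j) ≤ 6 * S.davLast P j by
        obtain ⟨j', h1, h2⟩ := h
        exact ⟨j', S.subset_foldl_filterStep P L _ h1, h2⟩
      by_cases hc : ∃ j' ∈ D, S.Conflict P j' j
      · obtain ⟨j', h1, h2⟩ := hc
        have hle := hD j' h1 j List.mem_cons_self
        refine ⟨j', S.subset_filterStep P D j h1, h2.1, hle, ?_⟩
        simpa [max_eq_right hle] using h2.2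
      · refine ⟨j, ?_, rfl, le_rfl, ?_⟩
        · rw [filterStep, if_neg hc]
          exact Finset.mem_insert_self _ _
        · rw [dist_self]
          exact mul_nonneg (by norm_num) (hnn j)
    · refine ih hL.2 (fun j' hj' j'' hj'' => ?_) hj
      rcases mem_filterStep hj' with h | rfl
      · exact hD j' h j'' (List.mem_cons_of_mem _ hj'')
      · exact hL.1 j'' hj''

lemma IsFilterOrder.dangerous_of_mem_filtered {L : List C} (hL : S.IsFilterOrder P L) {j : C}
    (hj : j ∈ S.filtered P L) : S.Dangerous P j := by
  rcases mem_foldl_filterStep (D := ∅) hj with h | h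
  · cases Finset.notMem_empty _ h
  · exact (hL.2.1 j).1 h

/-- Every dangerous client has a nearby representative in the filtered set. -/
lemma IsFilterOrder.exists_mem_filtered {L : List C} (hL : S.IsFilterOrder P L)
    (h : S.IsDuplication x y) {j : C} (hj : S.Dangerous P j) :
    ∃ j' ∈ S.filtered P L, I.r j' = I.r j ∧ S.davLast P j' ≤ S.davLast P j ∧
      dist (I.client j') (I.client j) ≤ 6 * S.davLast P j :=
  exists_mem_foldl_filterStep (IsUnitPartition.davLast_nonneg h) hL.2.2
    (fun _ h => absurd h (Finset.notMem_empty _)) ((hL.2.1 j).2 hj)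

lemma core_subset_laminarSet (S : Copies I F) (P : C → ℕ → Finset F) (D' : Finset C) (j : C) :
    S.core P j ⊆ S.laminarSet P D' j := by
  classical
  rw [laminarSet]
  exact Finset.subset_union_left

lemma mem_laminarSet {D' : Finset C} {j : C} {i : F} (hi : i ∈ S.laminarSet P D' j) :
    i ∈ S.core P j ∨ ∃ j' ∈ D', I.r j' < I.r j ∧
      ¬ Disjoint (S.laminarSet P D' j') (S.core P j) ∧ i ∈ S.laminarSet P D' j' := by
  classical
  rw [laminarSet, Finset.mem_union, Finset.mem_biUnion] at hi
  refine hi.imp_right ?_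
  rintro ⟨⟨j', hj'⟩, -, hi⟩
  rw [Finset.mem_filter] at hj'
  split_ifs at hi with hd
  · cases Finset.notMem_empty _ hi
  · exact ⟨j', hj'.1, hj'.2, hd, hi⟩

/-- `B'_j` is only slightly larger than `B_j`. -/
lemma IsUnitPartition.d_le_of_mem_laminarSet [Fintype F₀] (hP : S.IsUnitPartition P)
    (h : S.IsDuplication x y) (hnear : I.NearestAssignment x y) (hfeas : I.Feasible x y)
    {D' : Finset C} (hD' : ∀ j ∈ D', S.Dangerous P j) {j : C} (hj : j ∈ D') {i : F}
    (hi : i ∈ S.laminarSet P D' j) : S.d i j ≤ S.dmaxLast P j / 12 := by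
  induction hr : I.r j using Nat.strong_induction_on generalizing j i with
  | _ n ih =>
    have hm : 0 ≤ S.dmaxLast P j := S.dmax_nonneg _ _
    rcases mem_laminarSet hi with hi | ⟨j', hj', hlt, hmeet, hi⟩
    · have := S.mem_ball.1 hi
      linarith
    · obtain ⟨i', hi', hc⟩ := Finset.not_disjoint_iff.1 hmeet
      have e1 := ih _ (hr ▸ hlt) hj' hi rfl
      have e2 := ih _ (hr ▸ hlt) hj' hi' rfl
      have e3 := S.mem_ball.1 hc
      -- With `a_j < m_j / 45` this gives `m_{j'} ≤ (16/165) m_j`, so `i` is within `m_{j'} / 6 +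
      -- m_j / 15 ≤ (82/990) m_j < m_j / 12`.
      have e4 := hP.dmaxLast_le_davLast_add_dist h hnear hfeas hlt
      have e5 : dist (I.client j') (I.client j) ≤ S.d i' j' + S.d i' j := dist_triangle_left _ _ _
      have e6 := S.d_triangle i j j'
      have e7 := hD' j hj
      rw [dist_comm] at e6
      unfold Dangerous at e7
      linarith

end Filtering

/-! ### Connecting a client to the open facilities -/

section Connection

variable [Fintype F₀]

/-- Distinct open copies provide distinct open locations. -/
lemma AuxFeasible.serviceCost_le {𝒰 : Set (Finset F)} {D' : Finset C} {ζ : F → ℝ}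
    (hζ : S.AuxFeasible P 𝒰 D' ζ) (h01 : ∀ i, ζ i = 0 ∨ ζ i = 1) {j : C} {A : Finset F}
    (hcard : A.card = I.r j) (hA : ∀ i ∈ A, ζ i = 1) :
    I.serviceCost j (S.openLocations ζ) ≤ ((∑ i ∈ A, S.d i j : ℝ) : EReal) := by
  classical
  have hinj : Set.InjOn S.g A := by
    intro a ha b hb hab
    by_contra hne
    -- Two open copies of one location would violate its capacity 1.
    have hle : ∑ i ∈ {a, b}, ζ i ≤ ∑ i with S.g i = S.g b, ζ i := by
      refine Finset.sum_le_sum_of_subset_of_nonneg ?_ fun i _ _ => ?_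
      · intro i hi
        rw [Finset.mem_insert, Finset.mem_singleton] at hi
        rcases hi with rfl | rfl <;> simp [hab]
      · rcases h01 i with e | e <;> simp [e]
    have := hζ.location (S.g b)
    rw [Finset.sum_pair hne, hA a ha, hA b hb] at hle
    have h2 : (1 + 1 : ℝ) ≤ 1 := hle.trans (by convert this)
    norm_num at h2
  have hmem : A.image S.g ∈ (S.openLocations ζ).powersetCard (I.r j) := by
    rw [Finset.mem_powersetCard, Finset.card_image_of_injOn hinj]
    refine ⟨fun i₀ hi₀ => ?_, hcard⟩
    obtain ⟨i, hi, rfl⟩ := Finset.mem_image.1 hi₀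
    simpa [openLocations] using ⟨i, rfl, hA i hi⟩
  refine (Finset.inf_le hmem).trans (le_of_eq ?_)
  rw [Finset.sum_image hinj]
  rfl

/-- All parts but the last together contribute at most the total assignment cost. -/
lemma IsUnitPartition.sum_dmax_le (hP : S.IsUnitPartition P) (h : S.IsDuplication x y) (j : C) :
    ∑ p ∈ Finset.Icc 1 (I.r j - 1), S.dmax j (P j p) ≤ I.r j * I.dav x j := by
  rw [← h.sum_x_mul_d]
  refine le_trans ?_ (hP.sum_parts_le h j)
  -- Charge the maximum over each part to the average over the next one.
  calc ∑ p ∈ Finset.Icc 1 (I.r j - 1), S.dmax j (P j p)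
      ≤ ∑ p ∈ Finset.Icc 1 (I.r j - 1), ∑ i ∈ P j (p + 1), S.x i j * S.d i j :=
        Finset.sum_le_sum fun p hp => by
          rw [Finset.mem_Icc] at hp
          exact hP.dmax_le_avg h hp.1 (Nat.lt_succ_self p) (by omega)
    _ = ∑ p ∈ (Finset.Icc 1 (I.r j - 1)).map (addRightEmbedding 1),
          ∑ i ∈ P j p, S.x i j * S.d i j := by rw [Finset.sum_map]; rfl
    _ ≤ _ := by
        refine Finset.sum_le_sum_of_subset_of_nonneg (fun p hp => ?_) fun p _ _ =>
          Finset.sum_nonneg fun i _ => mul_nonneg (h.x_nonneg i j) (S.d_nonneg i j)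
        simp only [Finset.mem_map, Finset.mem_Icc, addRightEmbedding_apply] at hp ⊢
        obtain ⟨q, hq, rfl⟩ := hp
        omega

/-- The bundles provide `r_j - 1` cheap open facilities and one more at distance at most
`3 d_max^{r_j}(j)`. -/
lemma AuxFeasible.exists_open {s : BundleState F C} (hs : S.IsBundleOutcome s)
    (h : S.IsDuplication x y) (hP : S.IsUnitPartition P) {D' : Finset C} {ζ : F → ℝ}
    (hζ : S.AuxFeasible P s.bundles D' ζ) (h01 : ∀ i, ζ i = 0 ∨ ζ i = 1) (j : C) :
    ∃ A : Finset F, A.card = I.r j - 1 ∧ (∀ i ∈ A, ζ i = 1) ∧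
      ∑ i ∈ A, S.d i j ≤ 3 * I.r j * I.dav x j ∧
      ∃ i ∉ A, ζ i = 1 ∧ S.d i j ≤ 3 * S.dmaxLast P j := by
  classical
  obtain ⟨Q, hQ, hdisj, hnear⟩ := hs.exists_bundles h hP j
  have hex : ∀ p, ∃ i, p ∈ Finset.Icc 1 (I.r j) → i ∈ Q p ∧ ζ i = 1 := by
    intro p
    have hr : I.r j ∈ Finset.Icc 1 (I.r j) := Finset.mem_Icc.2 ⟨I.r_pos j, le_rfl⟩
    have key : ∀ q ∈ Finset.Icc 1 (I.r j), ∃ i ∈ Q q, ζ i = 1 := fun q hq => by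
      by_contra! hcon
      have := hζ.bundle _ (hQ q hq)
      rw [Finset.sum_eq_zero fun i hi => (h01 i).resolve_right (hcon i hi)] at this
      norm_num at this
    by_cases hp : p ∈ Finset.Icc 1 (I.r j)
    · obtain ⟨i, hi⟩ := key p hp
      exact ⟨i, fun _ => hi⟩
    · obtain ⟨i, -⟩ := key _ hr
      exact ⟨i, fun hp' => absurd hp' hp⟩
  choose f hf using hex
  have hinj : Set.InjOn f (Finset.Icc 1 (I.r j)) := fun p hp q hq e => by
    by_contra hne
    exact Finset.disjoint_left.1 (hdisj p hp q hq hne) (hf p hp).1 (e ▸ (hf q hq).1)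
  have hsub : Finset.Icc 1 (I.r j - 1) ⊆ Finset.Icc 1 (I.r j) :=
    Finset.Icc_subset_Icc le_rfl (Nat.sub_le _ _)
  have hr : I.r j ∈ Finset.Icc 1 (I.r j) := Finset.mem_Icc.2 ⟨I.r_pos j, le_rfl⟩
  refine ⟨(Finset.Icc 1 (I.r j - 1)).image f, ?_, ?_, ?_, f (I.r j), ?_, (hf _ hr).2,
    hnear _ hr _ (hf _ hr).1⟩
  · rw [Finset.card_image_of_injOn (hinj.mono (by exact_mod_cast hsub)), Nat.card_Icc]
    omega
  · intro i hi
    obtain ⟨p, hp, rfl⟩ := Finset.mem_image.1 hi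
    exact (hf p (hsub hp)).2
  · rw [Finset.sum_image (hinj.mono (by exact_mod_cast hsub)), mul_assoc]
    calc ∑ p ∈ Finset.Icc 1 (I.r j - 1), S.d (f p) j
        ≤ ∑ p ∈ Finset.Icc 1 (I.r j - 1), 3 * S.dmax j (P j p) :=
          Finset.sum_le_sum fun p hp => hnear p (hsub hp) _ (hf p (hsub hp)).1
      _ ≤ _ := by
          rw [← Finset.mul_sum]
          exact mul_le_mul_of_nonneg_left (hP.sum_dmax_le h j) (by norm_num)
  · intro hmem
    obtain ⟨p, hp, e⟩ := Finset.mem_image.1 hmem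
    have := hinj (hsub hp) hr e
    have := I.r_pos j
    rw [Finset.mem_Icc] at hp
    omega

variable {s : BundleState F C} {D' : Finset C} {ζ : F → ℝ}

/-- The cheap set `A` comes from the bundles and is not under control, so the last facility must be
found outside every possible `A`. -/
lemma AuxFeasible.serviceCost_le_add (hs : S.IsBundleOutcome s) (h : S.IsDuplication x y)
    (hP : S.IsUnitPartition P) (hζ : S.AuxFeasible P s.bundles D' ζ)
    (h01 : ∀ i, ζ i = 0 ∨ ζ i = 1) (j : C) {c : ℝ}
    (hc : ∀ A : Finset F, A.card = I.r j - 1 → (∃ i ∉ A, ζ i = 1 ∧ S.d i j ≤ 3 * S.dmaxLast P j) →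
      ∃ i ∉ A, ζ i = 1 ∧ S.d i j ≤ c) :
    I.serviceCost j (S.openLocations ζ) ≤ ((3 * I.r j * I.dav x j + c : ℝ) : EReal) := by
  classical
  obtain ⟨A, hcard, hA, hsum, hlast⟩ := hζ.exists_open hs h hP h01 j
  obtain ⟨i, hi, hi1, hid⟩ := hc A hcard hlast
  have hr := I.r_pos j
  refine (hζ.serviceCost_le h01 (A := insert i A) ?_ ?_).trans ?_
  · rw [Finset.card_insert_of_notMem hi]
    omega
  · intro i' hi'
    rcases Finset.mem_insert.1 hi' with rfl | hi'
    · exact hi1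
    · exact hA i' hi'
  · rw [EReal.coe_le_coe_iff, Finset.sum_insert hi]
    linarith

/-- The last facility comes from `B'_{j'}` if `r_j` facilities are open there, and from the last
bundle otherwise. -/
lemma AuxFeasible.serviceCost_le_laminar (hs : S.IsBundleOutcome s) (h : S.IsDuplication x y)
    (hP : S.IsUnitPartition P) (hζ : S.AuxFeasible P s.bundles D' ζ)
    (h01 : ∀ i, ζ i = 0 ∨ ζ i = 1) {j j' : C} (hj' : j' ∈ D') (hr : I.r j' = I.r j) {ρ : ℝ}
    (hρ : 0 ≤ ρ) :
    I.serviceCost j (S.openLocations ζ) ≤ ((3 * I.r j * I.dav x j +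
      (ρ + (∑ i ∈ S.laminarSet P D' j' with ρ < S.d i j, ζ i * S.d i j +
        3 * S.dmaxLast P j * (I.r j - ∑ i ∈ S.laminarSet P D' j', ζ i))) : ℝ) : EReal) := by
  classical
  set B := S.laminarSet P D' j' with hB
  obtain ⟨-, hle⟩ := hζ.laminar j' hj'
  rw [hr] at hle
  have hcount : ∑ i ∈ B, ζ i = ((B.filter (ζ · = 1)).card : ℝ) := by
    rw [Finset.card_filter, Nat.cast_sum]
    refine Finset.sum_congr rfl fun i _ => ?_
    rcases h01 i with e | e <;> simp [e]
  have hm : 0 ≤ S.dmaxLast P j := S.dmax_nonneg _ _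
  have hterm : ∀ i, 0 ≤ ζ i * S.d i j := fun i => by
    have := S.d_nonneg i j
    rcases h01 i with e | e <;> simp [e, this]
  have hsum : 0 ≤ ∑ i ∈ B with ρ < S.d i j, ζ i * S.d i j :=
    Finset.sum_nonneg fun i _ => hterm i
  refine hζ.serviceCost_le_add hs h hP h01 j fun A hcard ⟨i, hiA, hi1, hid⟩ => ?_
  by_cases hfull : I.r j ≤ (B.filter (ζ · = 1)).card
  -- Pigeonhole: `A` has only `r_j - 1` members.
  · obtain ⟨i', hi', hiA'⟩ : ∃ i' ∈ B.filter (ζ · = 1), i' ∉ A := by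
      by_contra! hcon
      have h1 := Finset.card_le_card (show B.filter (ζ · = 1) ⊆ A from hcon)
      have h2 := I.r_pos j
      omega
    rw [Finset.mem_filter] at hi'
    refine ⟨i', hiA', hi'.2, ?_⟩
    have h3 : 0 ≤ 3 * S.dmaxLast P j * (I.r j - ∑ i ∈ B, ζ i) :=
      mul_nonneg (by linarith) (by linarith)
    by_cases hd : ρ < S.d i' j
    · have hmem : i' ∈ B.filter (ρ < S.d · j) := Finset.mem_filter.2 ⟨hi'.1, hd⟩
      have := Finset.single_le_sum (f := fun i => ζ i * S.d i j) (fun i _ => hterm i) hmem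
      simp only [hi'.2, one_mul] at this
      linarith
    · linarith
  -- By integrality at least one opening is missing, so the deficit term pays for the last bundle.
  · refine ⟨i, hiA, hi1, hid.trans ?_⟩
    have h1 : ∑ i ∈ B, ζ i ≤ I.r j - 1 := by
      rw [hcount, le_sub_iff_add_le]
      exact_mod_cast not_le.1 hfull
    nlinarith

end Connection

/-! ### The rounded solution -/

section Rounding

variable {Ω : Type*} [MeasurableSpace Ω] {μ : Measure Ω} {𝒰 : Set (Finset F)} {D' : Finset C}
  {z : Ω → F → ℝ}

lemma IsRounding.integrable [IsFiniteMeasure μ] (hz : S.IsRounding P 𝒰 D' μ z) (i : F) :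
    Integrable (fun ω => z ω i) μ := by
  refine Integrable.of_bound ((measurable_pi_apply i).comp hz.measurable).aestronglyMeasurable 1 ?_
  filter_upwards [hz.integral_solution] with ω hω
  rcases hω.1 i with e | e <;> simp [e]

lemma IsRounding.integral_sum_mul [IsFiniteMeasure μ] (hz : S.IsRounding P 𝒰 D' μ z)
    (A : Finset F) (w : F → ℝ) : ∫ ω, ∑ i ∈ A, z ω i * w i ∂μ = ∑ i ∈ A, S.y i * w i := by
  rw [integral_finsetSum _ fun i _ => (hz.integrable i).mul_const _]
  exact Finset.sum_congr rfl fun i _ => by rw [integral_mul_const, hz.mean]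

/-- An almost surely nonnegative integrable bound on the excess cost can be made nonnegative. -/
lemma exists_nonneg_excess {f : Ω → ℝ} {cost : Ω → EReal} {base bound : ℝ} (hm : Measurable f)
    (hint : Integrable f μ) (hf : ∀ᵐ ω ∂μ, 0 ≤ f ω)
    (hcost : ∀ᵐ ω ∂μ, cost ω ≤ ((base + f ω : ℝ) : EReal)) (hbound : ∫ ω, f ω ∂μ ≤ bound) :
    ∃ Y : Ω → ℝ, Measurable Y ∧ Integrable Y μ ∧ (∀ ω, 0 ≤ Y ω) ∧
      (∀ᵐ ω ∂μ, cost ω ≤ ((base + Y ω : ℝ) : EReal)) ∧ ∫ ω, Y ω ∂μ ≤ bound := by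
  refine ⟨fun ω => max (f ω) 0, hm.max measurable_const, hint.pos_part,
    fun ω => le_max_right _ _, ?_, ?_⟩
  · filter_upwards [hcost] with ω hω
    refine hω.trans (EReal.coe_le_coe_iff.2 ?_)
    gcongr
    exact le_max_left _ _
  · refine (integral_congr_ae ?_).trans_le hbound
    filter_upwards [hf] with ω hω
    exact max_eq_left hω

end Rounding

/-- The volume missing in `A` is assigned outside of `A`. -/
lemma IsDuplication.r_sub_vol_le [Fintype F₀] [DecidableEq F] (h : S.IsDuplication x y)
    (hfeas : I.Feasible x y) (j : C) {A B : Finset F} (hAB : A ⊆ B) :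
    I.r j - S.vol B ≤ ∑ i ∈ Aᶜ, S.x i j := by
  have h1 : ∑ i ∈ A, S.x i j ≤ S.vol B :=
    (Finset.sum_le_sum fun i _ => h.x_le_y i j).trans (h.vol_mono hAB)
  have h2 := Finset.sum_add_sum_compl A fun i => S.x i j
  rw [h.sum_x_eq hfeas] at h2
  linarith

end FaultTolerant.Copies

namespace FaultTolerant.Copies

variable {X F₀ C F : Type*} [PseudoMetricSpace X] [Fintype F] {I : Instance X F₀ C}
  {S : Copies I F} {x : F₀ → C → ℝ} {y : F₀ → ℝ} {P : C → ℕ → Finset F}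

/-! ### The expected excess of a dangerous client -/

section Excess

variable [Fintype F₀]

lemma d_le_add_trunc (S : Copies I F) {T : ℝ} (hT : 0 ≤ T) (i : F) (j : C) :
    S.d i j ≤ T + I.trunc T (S.g i) j := by
  unfold Instance.trunc d
  split_ifs with h <;> linarith

lemma trunc_nonneg (S : Copies I F) (T : ℝ) (i : F) (j : C) : 0 ≤ I.trunc T (S.g i) j := by
  unfold Instance.trunc
  split_ifs
  exacts [S.d_nonneg i j, le_rfl]

lemma IsDuplication.sum_mul_le_trunc (h : S.IsDuplication x y) {T : ℝ} (j : C) (A : Finset F)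
    (w : F → ℝ) (hw : ∀ i ∈ A, T ≤ S.d i j ∧ w i ≤ S.d i j) :
    ∑ i ∈ A, S.x i j * w i ≤ ∑ i, x i j * I.trunc T i j := by
  rw [← h.sum_x_mul]
  refine le_trans (Finset.sum_le_sum fun i hi => ?_)
    (Finset.sum_le_sum_of_subset_of_nonneg (Finset.subset_univ A)
      fun i _ _ => mul_nonneg (h.x_nonneg i j) (S.trunc_nonneg T i j))
  refine mul_le_mul_of_nonneg_left ?_ (h.x_nonneg i j)
  rw [Instance.trunc, if_pos (show T ≤ I.d (S.g i) j from (hw i hi).1)]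
  exact (hw i hi).2

/-- The last part has volume 1, so replacing each distance by `T` plus its truncation costs just one
`T`. -/
lemma IsUnitPartition.davLast_le (hP : S.IsUnitPartition P) (h : S.IsDuplication x y) {T : ℝ}
    (hT : 0 ≤ T) (j : C) : S.davLast P j ≤ T + ∑ i, x i j * I.trunc T i j := by
  have hr := I.r_pos j
  have hvol := hP.vol_eq_one j (I.r j) hr le_rfl
  rw [vol, ← Finset.sum_congr rfl fun i hi =>
    h.x_eq_y_of_mem_supp (hP.subset_supp hr le_rfl hi)] at hvol
  calc S.davLast P j
      ≤ ∑ i ∈ P j (I.r j), (S.x i j * T + S.x i j * I.trunc T (S.g i) j) :=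
        Finset.sum_le_sum fun i _ => by
          rw [← mul_add]
          exact mul_le_mul_of_nonneg_left (S.d_le_add_trunc hT i j) (h.x_nonneg i j)
    _ = T + ∑ i ∈ P j (I.r j), S.x i j * I.trunc T (S.g i) j := by
        rw [Finset.sum_add_distrib, ← Finset.sum_mul, hvol, one_mul]
    _ ≤ _ := by
        rw [← h.sum_x_mul j fun i => I.trunc T i j]
        gcongr
        · exact fun i _ _ => mul_nonneg (h.x_nonneg i j) (S.trunc_nonneg T i j)
        · exact Finset.subset_univ _

/-- For a dangerous client `j` with representative `j'`, the threshold `ρ` and the constant `c`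
for which connecting to `B'_{j'}` beyond distance `ρ`, or to the last bundle, is cheap on average. -/
lemma IsUnitPartition.exists_threshold (hP : S.IsUnitPartition P) (h : S.IsDuplication x y)
    (hnear : I.NearestAssignment x y) (hfeas : I.Feasible x y) {D' : Finset C}
    (hD' : ∀ j ∈ D', S.Dangerous P j) {j j' : C} (hj' : j' ∈ D') (hr : I.r j' = I.r j)
    (ha : S.davLast P j' ≤ S.davLast P j)
    (hdist : dist (I.client j') (I.client j) ≤ 6 * S.davLast P j) {T : ℝ} (hT : 0 ≤ T)
    (hbig : 435.6 * T + 226.7 * ∑ i, x i j * I.trunc T i j < 3 * S.dmaxLast P j) :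
    ∃ ρ c : ℝ, 0 ≤ ρ ∧ 0 ≤ c ∧ ρ ≤ c + 435.6 * T ∧
      c + (∑ i ∈ S.laminarSet P D' j' with ρ < S.d i j, S.y i * S.d i j +
        3 * S.dmaxLast P j * (I.r j - ∑ i ∈ S.laminarSet P D' j', S.y i)) ≤
      226.7 * ∑ i, x i j * I.trunc T i j := by
  classical
  set Λ := ∑ i, x i j * I.trunc T i j with hΛ
  have haΛ : S.davLast P j ≤ T + Λ := hP.davLast_le h hT j
  have ha0 : 0 ≤ S.davLast P j := davLast_nonneg h j
  have hm' : S.dmaxLast P j ≤ S.dmaxLast P j' + dist (I.client j') (I.client j) := by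
    rw [dist_comm]
    exact hP.dmaxLast_le_add_dist h hnear hfeas hr.symm
  have hm'' := hP.dmaxLast_le_add_dist h hnear hfeas hr
  set a := S.davLast P j
  set m := S.dmaxLast P j
  set m' := S.dmaxLast P j'
  set B := S.laminarSet P D' j'
  have hm0 : 0 ≤ m := S.dmax_nonneg _ _
  have hΛ0 : 0 ≤ Λ := by
    rw [hΛ, ← h.sum_x_mul j fun i => I.trunc T i j]
    exact Finset.sum_nonneg fun i _ => mul_nonneg (h.x_nonneg i j) (S.trunc_nonneg T i j)
  have hxy : ∀ i ∈ B, S.y i = S.x i j := fun i hi => by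
    refine (hP.x_eq_y_of_lt_dmaxLast h hnear ?_).symm
    have e1 := hP.d_le_of_mem_laminarSet h hnear hfeas hD' hj' hi
    have e2 := S.d_triangle i j j'
    rw [dist_comm] at e2
    change S.d i j < m
    linarith
  have hsum : ∀ ρ, ∑ i ∈ B with ρ < S.d i j, S.y i * S.d i j =
      ∑ i ∈ B with ρ < S.d i j, S.x i j * S.d i j := fun ρ =>
    Finset.sum_congr rfl fun i hi => by rw [hxy i (Finset.mem_filter.1 hi).1]
  have hfar : ∀ i ∈ (S.core P j')ᶜ, m' / 15 < S.d i j' := fun i hi => by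
    rw [Finset.mem_compl, core, mem_ball, not_le] at hi
    exact hi
  have hcore : S.core P j' ⊆ B := S.core_subset_laminarSet P D' j'
  have hdang : 45 * S.davLast P j' < m' := hD' j' hj'
  have ha'0 : 0 ≤ S.davLast P j' := davLast_nonneg h j'
  set δ := I.r j - ∑ i ∈ B, S.y i with hδ
  rcases le_total (1.4 * T) a with hcase | hcase
  -- Here `a ≤ T + Λ` and `T ≤ a / 1.4` give `a ≤ 3.5 Λ`. The total is at most `a + a + 49.5 a =
  -- 51.5 a ≤ 180.25 Λ`.
  · refine ⟨a, a, ha0, ha0, by linarith, ?_⟩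
    have e1 : ∑ i ∈ B with a < S.d i j, S.y i * S.d i j ≤ a := by
      rw [hsum]
      exact hP.sum_far_le_davLast h j _ fun i hi => (Finset.mem_filter.1 hi).2
    -- Markov's inequality for `j'`: its missing volume is served beyond `m' / 15`, hence by its
    -- last part, whose cost is at most `a`.
    have e2 : δ * (m' / 15) ≤ a := by
      refine le_trans ?_ ha
      refine le_trans ?_ (hP.sum_far_le_davLast h j' (S.core P j')ᶜ fun i hi => ?_)
      · have := h.r_sub_vol_le hfeas j' hcore
        rw [hr] at this
        refine (mul_le_mul_of_nonneg_right this (by linarith)).trans ?_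
        rw [Finset.sum_mul]
        exact Finset.sum_le_sum fun i hi =>
          mul_le_mul_of_nonneg_left (hfar i hi).le (h.x_nonneg i j')
      · have := hfar i hi
        linarith
    have e3 : 3 * m * δ ≤ 49.5 * a := by
      rcases le_total δ 0 with h0 | h0
      · nlinarith
      · have : m ≤ 1.1 * m' := by linarith
        nlinarith
    linarith
  -- The `435.6 T` allowance absorbs `ρ`, so no constant `c` is needed.
  · refine ⟨1.4 * T, 0, by linarith, le_rfl, by linarith, ?_⟩
    have e1 : ∑ i ∈ B with 1.4 * T < S.d i j, S.y i * S.d i j ≤ Λ := by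
      rw [hsum]
      refine h.sum_mul_le_trunc j _ _ fun i hi => ⟨?_, le_rfl⟩
      have := (Finset.mem_filter.1 hi).2
      linarith
    -- Seen from `j`, copies outside the core are beyond `m' / 15 - 6 a ≥ (m - 6 a) / 15 - 6 a`,
    -- which is this radius. That it reaches `T` follows from `hbig` by combining `a ≤ 1.4 T` with
    -- `a ≤ T + Λ`.
    have hR : T ≤ (m - 96 * a) / 15 := by linarith
    have e2 : δ * ((m - 96 * a) / 15) ≤ Λ := by
      refine (mul_le_mul_of_nonneg_right (h.r_sub_vol_le hfeas j hcore) (by linarith)).trans ?_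
      rw [Finset.sum_mul]
      refine h.sum_mul_le_trunc j _ (fun _ => (m - 96 * a) / 15) fun i hi => ?_
      have h1 := hfar i hi
      have h2 := S.d_triangle i j' j
      constructor <;> linarith
    have e3 : 3 * m * δ ≤ 200 * Λ := by
      rcases le_total δ 0 with h0 | h0
      · nlinarith
      · have : 3 * m ≤ 200 * ((m - 96 * a) / 15) := by linarith
        nlinarith
    linarith

end Excess

end FaultTolerant.Copies

/-! ### The excess variable in the two regimes. -/

theorem mainTheorem6
    {X F₀ C F Ω : Type*} [PseudoMetricSpace X] [Fintype F₀] [Fintype C] [Fintype F]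
    [MeasurableSpace Ω] (μ : Measure Ω) [IsProbabilityMeasure μ]
    -- the instance and the fractional solution
    (I : FaultTolerant.Instance X F₀ C) (x : F₀ → C → ℝ) (y : F₀ → ℝ)
    (hfeas : I.Feasible x y) (hnear : I.NearestAssignment x y)
    -- the facility duplication and the partitions into unit volumes
    (S : FaultTolerant.Copies I F) (hdup : S.IsDuplication x y)
    (P : C → ℕ → Finset F) (hP : S.IsUnitPartition P)
    -- the outcome of bundle creation
    (s : FaultTolerant.Copies.BundleState F C) (hs : S.IsBundleOutcome s)
    -- the order in which dangerous clients are filtered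
    (L : List C) (hL : S.IsFilterOrder P L)
    -- the rounded solution
    (z : Ω → F → ℝ) (hz : S.IsRounding P s.bundles (S.filtered P L) μ z)
    (j : C) (T : ℝ) (hT : 0 ≤ T) :
    ∃ Xj : Ω → ℝ, Measurable Xj ∧ Integrable Xj μ ∧ (∀ ω, 0 ≤ Xj ω) ∧
      (∀ᵐ ω ∂μ, I.serviceCost j (S.openLocations (z ω)) ≤
        ((3 * I.r j * I.dav x j + 435.6 * T + Xj ω : ℝ) : EReal)) ∧
      ∫ ω, Xj ω ∂μ ≤ 226.7 * ∑ i, x i j * I.trunc T i j := by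
  by_cases hbig : 435.6 * T + 226.7 * ∑ i, x i j * I.trunc T i j < 3 * S.dmaxLast P j
  -- `135 a ≤ 135 (T + Λ)`, and 135 is below both constants in `hbig`.
  · have hdang : S.Dangerous P j := by
      have := hP.davLast_le hdup hT j
      have : 0 ≤ S.davLast P j := FaultTolerant.Copies.IsUnitPartition.davLast_nonneg hdup j
      unfold FaultTolerant.Copies.Dangerous
      linarith
    obtain ⟨j', hj', hrj, ha, hdist⟩ := hL.exists_mem_filtered hdup hdang
    obtain ⟨ρ, c, hρ, hc, hρc, hbound⟩ := hP.exists_threshold hdup hnear hfeas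
      (fun _ => hL.dangerous_of_mem_filtered) hj' hrj ha hdist hT hbig
    have hm : 0 ≤ S.dmaxLast P j := S.dmax_nonneg _ _
    have hint : ∀ (A : Finset F) (w : F → ℝ), Integrable (fun ω => ∑ i ∈ A, z ω i * w i) μ :=
      fun A w => integrable_finsetSum _ fun i _ => (hz.integrable i).mul_const _
    have hmeas : ∀ (A : Finset F) (w : F → ℝ), Measurable fun ω => ∑ i ∈ A, z ω i * w i :=
      fun A w => Finset.measurable_fun_sum _ fun i _ =>
        ((measurable_pi_apply i).comp hz.measurable).mul_const _
    set B := S.laminarSet P (S.filtered P L) j'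
    have hint1 : Integrable (fun ω => ∑ i ∈ B, z ω i) μ := by simpa using hint B fun _ => 1
    have hmeas1 : Measurable fun ω => ∑ i ∈ B, z ω i := by simpa using hmeas B fun _ => 1
    have hint2 : Integrable
        (fun ω => 3 * S.dmaxLast P j * ((I.r j : ℝ) - ∑ i ∈ B, z ω i)) μ :=
      ((integrable_const _).sub hint1).const_mul _
    have hint3 : Integrable (fun ω => ∑ i ∈ B with ρ < S.d i j, z ω i * S.d i j +
        3 * S.dmaxLast P j * (I.r j - ∑ i ∈ B, z ω i)) μ := (hint _ _).add hint2
    refine FaultTolerant.Copies.exists_nonneg_excess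
      (f := fun ω => c + (∑ i ∈ B with ρ < S.d i j, z ω i * S.d i j +
        3 * S.dmaxLast P j * (I.r j - ∑ i ∈ B, z ω i)))
      (((hmeas _ _).add ((hmeas1.const_sub _).const_mul _)).const_add _)
      ((integrable_const _).add hint3) ?_ ?_ ?_
    · filter_upwards [hz.integral_solution] with ω hω
      have h1 := (hω.2.laminar j' hj').2
      rw [hrj] at h1
      refine add_nonneg hc (add_nonneg (Finset.sum_nonneg fun i _ => ?_)
        (mul_nonneg (by linarith) (sub_nonneg.2 h1)))
      have := S.d_nonneg i j
      rcases hω.1 i with e | e <;> simp [e, this]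
    · filter_upwards [hz.integral_solution] with ω hω
      refine (hω.2.serviceCost_le_laminar hs hdup hP hω.1 hj' hrj hρ).trans
        (EReal.coe_le_coe_iff.2 ?_)
      linarith
    · rw [integral_add (integrable_const _) hint3,
        integral_add (hint _ _) hint2, hz.integral_sum_mul, integral_const_mul,
        integral_sub (integrable_const _) hint1, integral_finsetSum _ fun i _ => hz.integrable i]
      simpa [hz.mean] using hbound
  · rw [not_lt] at hbig
    have hnn : 0 ≤ ∑ i, x i j * I.trunc T i j := by
      rw [← hdup.sum_x_mul j fun i => I.trunc T i j]
      exact Finset.sum_nonneg fun i _ => mul_nonneg (hdup.x_nonneg i j) (S.trunc_nonneg T i j)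
    -- The last bundle is already affordable, so a deterministic excess works.
    refine ⟨fun _ => 226.7 * ∑ i, x i j * I.trunc T i j, measurable_const, integrable_const _,
      fun _ => by positivity, ?_, by simp⟩
    filter_upwards [hz.integral_solution] with ω hω
    refine (hω.2.serviceCost_le_add hs hdup hP hω.1 j (c := 3 * S.dmaxLast P j)
      fun _ _ h => h).trans (EReal.coe_le_coe_iff.2 ?_)
    linarith
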